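/- There is an absolute constant $C>0$ such that the following holds for every integer $n\ge 2$, every $p\in[2,\infty]$ and every $\chi>0$. Let $\mathcal C$ be the set of all convex functions $f:\mathbf R^n\to\mathbf R$ that are Lipschitz continuous with constant $1$ with respect to $\|\cdot\|_p$. There is a map $f\mapsto \mathcal S_\chi[f]$ that assigns to every $f\in\mathcal C$ a convex continuously differentiable function $\mathcal S_\chi[f]:\mathbf R^n\to\mathbf R$ such that: (i) $f(x)\ge \mathcal S_\chi[f](x)\ge f(x)-\chi$ for all $f\in\mathcal C$ and $x\in\mathbf R^n$; (ii) $\|\nabla \mathcal S_\chi[f](x)-\nabla \mathcal S_\chi[f](y)\|_{q}\le C\,\min[p,\ln n]\,\chi^{-1}\,\|x-y\|_p$ for all $f\in\mathcal C$ and $x,y\in\mathbf R^n$, where $q=\frac{p}{p-1}$ (and $q=1$ if $p=\infty$); (iii) every $x\in\mathbf R^n$ has a neighbourhood $U$ such that the restriction of $\mathcal S_\chi[f]$ to $U$ depends only on the restriction of $f$ to $B^p_\chi(x)=\{y:\|y-x\|_p\le\chi\}$; that is, whenever $f,g\in\mathcal C$ coincide on $B^p_\chi(x)$, the functions $\mathcal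 S_\chi[f]$ and $\mathcal S_\chi[g]$ coincide on $U$. -/

import Mathlib

open scoped ENNReal Topology

/-- The `p`-norm on `ℝⁿ`: `‖x‖_p = (∑ |x_j|^p)^(1/p)` for `0 < p < ∞`, and
`‖x‖_∞ = max |x_j|`. -/
noncomputable def pNorm {n : ℕ} (p : ℝ≥0∞) (x : EuclideanSpace ℝ (Fin n)) : ℝ :=
  ‖WithLp.toLp p (WithLp.ofLp x)‖

/-- The closed `‖·‖_p`-ball of radius `χ` centred at `x`. -/
def pBall {n : ℕ} (p : ℝ≥0∞) (x : EuclideanSpace ℝ (Fin n)) (χ : ℝ) :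
    Set (EuclideanSpace ℝ (Fin n)) :=
  {y | pNorm p (y - x) ≤ χ}

/-- The convex functions on `ℝⁿ` that are Lipschitz continuous with constant `1`
with respect to `‖·‖_p`. -/
def convexLip {n : ℕ} (p : ℝ≥0∞) : Set (EuclideanSpace ℝ (Fin n) → ℝ) :=
  {f | ConvexOn ℝ Set.univ f ∧ ∀ x y, |f x - f y| ≤ pNorm p (x - y)}

/-! The smoothing is the inf-convolution of `f` with a penalty `c * ρ h ^ r` over the ball `ρ h ≤ 2
* R`, where `R = χ / 4` and `ρ` is an `r`-norm with `r` of order `min p (log n)`, within a factor 3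
of the `p`-norm (`exists_exponent_pNorm_equiv`). The small radius gives closeness to `f` and
locality; joint convexity gives convexity.

For smoothness, `c = 2 / (r * R ^ (r - 1))` is large enough to hold minimizers `h` in `ρ h ≤ R`
(`seminorm_le_of_isMin`), so small perturbations of `h` remain admissible. Passing from `x` to `x +
d` with `h - d` in place of `h` leaves the argument of `f` fixed, and only the penalty changes. The
second-order bound for `ρ ^ r` (`exists_pSeminorm_add_rpow_le`) then gives a quadratic upper model
with constant of order `c * r ^ 2 * R ^ (r - 2)`, that is `r / R`, with no smoothness of `f` used.

A convex function with such a model at every point has a Lipschitz gradient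
(`ConvexOn.contDiff_one_and_inner_gradient_sub_le`), and `p`-`q` duality turns the bound on inner
products into the `q`-norm bound. -/

/-! ### Scalar power inequalities and Hölder's inequality. -/

/-- Tangent line inequality for `x ↦ x ^ s` on the nonnegative half-line. -/
lemma rpow_add_mul_sub_le_rpow {a b s : ℝ} (ha : 0 ≤ a) (hb : 0 ≤ b) (hs : 1 ≤ s) :
    a ^ s + s * a ^ (s - 1) * (b - a) ≤ b ^ s := by
  rcases ha.eq_or_lt with rfl | ha
  · rcases hs.eq_or_lt with rfl | hs
    · simp
    · rw [Real.zero_rpow (by linarith), Real.zero_rpow (by linarith)]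
      simpa using Real.rpow_nonneg hb s
  · have h := one_add_mul_self_le_rpow_one_add (s := b / a - 1)
      (by linarith [div_nonneg hb ha.le]) hs
    have e : b ^ s = a ^ s * (1 + (b / a - 1)) ^ s := by
      rw [← Real.mul_rpow ha.le (by linarith [div_nonneg hb ha.le])]
      congr 1
      field_simp
      ring
    have e2 : a ^ s = a ^ (s - 1) * a := by
      rw [← Real.rpow_add_one ha.ne']; congr 1; ring
    rw [e]
    calc a ^ s + s * a ^ (s - 1) * (b - a) = a ^ s * (1 + s * (b / a - 1)) := by
          rw [e2]; field_simp
      _ ≤ _ := mul_le_mul_of_nonneg_left h (Real.rpow_nonneg ha.le s)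

lemma rpow_sub_one_eq_rpow_sub_two_mul {a r : ℝ} (ha : 0 ≤ a) (hr : 2 ≤ r) : a ^ (r - 1) = a ^ (r - 2) * a := by
  rw [← Real.rpow_add_one' ha (by linarith)]; congr 1; ring

/-- With `A = |u| ^ (r - 2)` and `B = |t| ^ (r - 2)`, the left side is `A * (u - t) ^ 2 + (A - B) *
t * (u - t)`, and the tangent line inequality for the power `r - 1` bounds `(A - B) * |t|` by `(r -
2) * A * (|u| - |t|)`. -/
lemma abs_rpow_grad_sub_mul_le_aux {t u r : ℝ} (hr : 2 ≤ r) (htu : |t| ≤ |u|) :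
    (|u| ^ (r - 2) * u - |t| ^ (r - 2) * t) * (u - t) ≤ (r - 1) * |u| ^ (r - 2) * (u - t) ^ 2 := by
  have hA := Real.rpow_nonneg (abs_nonneg u) (r - 2)
  have hAB := Real.rpow_le_rpow (abs_nonneg t) htu (by linarith : 0 ≤ r - 2)
  have h := rpow_add_mul_sub_le_rpow (abs_nonneg u) (abs_nonneg t) (by linarith : 1 ≤ r - 1)
  rw [rpow_sub_one_eq_rpow_sub_two_mul (abs_nonneg u) hr, rpow_sub_one_eq_rpow_sub_two_mul (abs_nonneg t) hr,
    show r - 1 - 1 = r - 2 by ring] at h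
  set A := |u| ^ (r - 2)
  set B := |t| ^ (r - 2)
  have h1 : (A - B) * |t| ≤ (r - 2) * A * |u - t| := by
    have : |u| - |t| ≤ |u - t| := abs_sub_abs_le_abs_sub u t
    have := mul_le_mul_of_nonneg_left this (mul_nonneg (by linarith : 0 ≤ r - 2) hA)
    linarith
  have h2 : (A - B) * (t * (u - t)) ≤ (A - B) * (|t| * |u - t|) :=
    mul_le_mul_of_nonneg_left (by rw [← abs_mul]; exact le_abs_self _) (by linarith)
  have h3 := mul_le_mul_of_nonneg_right h1 (abs_nonneg (u - t))
  have h4 : |u - t| * |u - t| = (u - t) ^ 2 := by rw [← sq, sq_abs]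
  rw [mul_assoc _ |u - t|, h4] at h3
  linarith

lemma abs_rpow_grad_sub_mul_le {t u r m : ℝ} (hr : 2 ≤ r) (ht : |t| ≤ m) (hu : |u| ≤ m) :
    (|u| ^ (r - 2) * u - |t| ^ (r - 2) * t) * (u - t) ≤ (r - 1) * m ^ (r - 2) * (u - t) ^ 2 := by
  have key : ∀ {a}, |a| ≤ m →
      (r - 1) * |a| ^ (r - 2) * (u - t) ^ 2 ≤ (r - 1) * m ^ (r - 2) * (u - t) ^ 2 := fun ha => by
    have := Real.rpow_le_rpow (abs_nonneg _) ha (by linarith : 0 ≤ r - 2)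
    have : 0 ≤ r - 1 := by linarith
    gcongr
  rcases le_total |t| |u| with h | h
  · exact (abs_rpow_grad_sub_mul_le_aux hr h).trans (key hu)
  · have := abs_rpow_grad_sub_mul_le_aux hr h
    have := key ht
    linarith [sq_abs (u - t), show (t - u) ^ 2 = (u - t) ^ 2 by ring,
      congrArg (fun z => (r - 1) * |t| ^ (r - 2) * z) (show (t - u) ^ 2 = (u - t) ^ 2 by ring)]

/-- Second-order upper Taylor bound for `|·| ^ r`, `r ≥ 2`. -/
lemma abs_add_rpow_le {r : ℝ} (hr : 2 ≤ r) (t d : ℝ) :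
    |t + d| ^ r ≤ |t| ^ r + r * (|t| ^ (r - 2) * t) * d
      + r * (r - 1) * ((|t| + |d|) ^ (r - 2) * d ^ 2) := by
  -- The tangent is taken at the endpoint `t + d`; replacing its slope by that at `t` costs the
  -- gradient difference bounded in `h2`.
  have h1 := rpow_add_mul_sub_le_rpow (abs_nonneg (t + d)) (abs_nonneg t) (by linarith : 1 ≤ r)
  rw [rpow_sub_one_eq_rpow_sub_two_mul (abs_nonneg (t + d)) hr] at h1
  have h2 := abs_rpow_grad_sub_mul_le (t := t) (u := t + d) (m := |t| + |d|) hr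
    (by linarith [abs_nonneg d]) (abs_add_le t d)
  rw [show t + d - t = d by ring] at h2
  have hA : 0 ≤ r * |t + d| ^ (r - 2) :=
    mul_nonneg (by linarith) (Real.rpow_nonneg (abs_nonneg _) _)
  have h3 : (t + d) * t ≤ |t + d| * |t| := by rw [← abs_mul]; exact le_abs_self _
  have h4 := mul_le_mul_of_nonneg_left h3 hA
  have h5 := mul_le_mul_of_nonneg_left h2 (by linarith : 0 ≤ r)
  have h6 : |t + d| * |t + d| = (t + d) * (t + d) := abs_mul_abs_self _
  have h7 : r * |t + d| ^ (r - 2) * (|t + d| * |t + d|)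
    = r * |t + d| ^ (r - 2) * ((t + d) * (t + d)) := by rw [h6]
  linarith

/-- Hölder's inequality with exponents `r / (r - 2)` and `r / 2`. -/
lemma sum_rpow_sub_two_mul_sq_le {ι : Type*} (s : Finset ι) {r A B : ℝ} (hr : 2 ≤ r) {u v : ι → ℝ}
    (hu : ∀ i, 0 ≤ u i) (hv : ∀ i, 0 ≤ v i) (hA : 0 < A) (hB : 0 < B)
    (huA : ∑ i ∈ s, u i ^ r ≤ A ^ r) (hvB : ∑ i ∈ s, v i ^ r ≤ B ^ r) :
    ∑ i ∈ s, u i ^ (r - 2) * v i ^ 2 ≤ A ^ (r - 2) * B ^ 2 := by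
  have hr0 : 0 < r := by linarith
  have hAr := Real.rpow_pos_of_pos hA r
  have hBr := Real.rpow_pos_of_pos hB r
  have hA2 := Real.rpow_pos_of_pos hA (r - 2)
  have key : ∀ i, u i ^ (r - 2) * v i ^ 2 ≤ A ^ (r - 2) * B ^ 2 *
      ((r - 2) / r * (u i ^ r / A ^ r) + 2 / r * (v i ^ r / B ^ r)) := fun i => by
    -- Weighted AM-GM after normalising by `A` and `B`; the weights sum to 1.
    have h := Real.geom_mean_le_arith_mean2_weighted (w₁ := (r - 2) / r) (w₂ := 2 / r)
      (p₁ := u i ^ r / A ^ r) (p₂ := v i ^ r / B ^ r) (div_nonneg (by linarith) hr0.le)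
      (by positivity) (div_nonneg (Real.rpow_nonneg (hu i) _) hAr.le)
      (div_nonneg (Real.rpow_nonneg (hv i) _) hBr.le) (by field_simp; ring)
    rw [← Real.div_rpow (hu i) hA.le, ← Real.div_rpow (hv i) hB.le,
      ← Real.rpow_mul (div_nonneg (hu i) hA.le), ← Real.rpow_mul (div_nonneg (hv i) hB.le),
      mul_div_cancel₀ _ hr0.ne', mul_div_cancel₀ _ hr0.ne', Real.rpow_two,
      Real.div_rpow (hu i) hA.le, div_pow, Real.div_rpow (hu i) hA.le,
      Real.div_rpow (hv i) hB.le] at h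
    calc u i ^ (r - 2) * v i ^ 2
        = A ^ (r - 2) * B ^ 2 * (u i ^ (r - 2) / A ^ (r - 2) * (v i ^ 2 / B ^ 2)) := by
          field_simp
      _ ≤ _ := mul_le_mul_of_nonneg_left h (by positivity)
  calc ∑ i ∈ s, u i ^ (r - 2) * v i ^ 2
      ≤ ∑ i ∈ s, A ^ (r - 2) * B ^ 2 *
        ((r - 2) / r * (u i ^ r / A ^ r) + 2 / r * (v i ^ r / B ^ r)) :=
        Finset.sum_le_sum fun i _ => key i
    _ = A ^ (r - 2) * B ^ 2 * ((r - 2) / r * ((∑ i ∈ s, u i ^ r) / A ^ r)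
        + 2 / r * ((∑ i ∈ s, v i ^ r) / B ^ r)) := by
        rw [← Finset.mul_sum, Finset.sum_add_distrib, ← Finset.mul_sum, ← Finset.mul_sum,
          Finset.sum_div, Finset.sum_div]
    _ ≤ A ^ (r - 2) * B ^ 2 * ((r - 2) / r * 1 + 2 / r * 1) := by
        have : 0 ≤ (r - 2) / r := div_nonneg (by linarith) hr0.le
        have := (div_le_one hAr).2 huA
        have := (div_le_one hBr).2 hvB
        gcongr
    _ = A ^ (r - 2) * B ^ 2 := by field_simp; ring

/-! ### The `p`-norm as a seminorm, and powers of the `r`-norm. -/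

section pNorm

variable {n : ℕ} {p : ℝ≥0∞}

/-- `pNorm p` as a seminorm, for `1 ≤ p`. -/
noncomputable def pSeminorm (n : ℕ) (p : ℝ≥0∞) [Fact (1 ≤ p)] :
    Seminorm ℝ (EuclideanSpace ℝ (Fin n)) :=
  (normSeminorm ℝ (PiLp p fun _ : Fin n => ℝ)).comp
    ((WithLp.linearEquiv p ℝ (Fin n → ℝ)).symm.toLinearMap ∘ₗ
      (WithLp.linearEquiv 2 ℝ (Fin n → ℝ)).toLinearMap)

lemma pSeminorm_apply [Fact (1 ≤ p)] (x : EuclideanSpace ℝ (Fin n)) :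
    pSeminorm n p x = pNorm p x := rfl

lemma continuous_pSeminorm [Fact (1 ≤ p)] : Continuous (pSeminorm n p) := by
  change Continuous fun x : EuclideanSpace ℝ (Fin n) => ‖WithLp.toLp p (WithLp.ofLp x)‖
  exact continuous_norm.comp
    ((PiLp.continuous_toLp p _).comp (PiLp.continuous_ofLp 2 _))

lemma eq_zero_of_pSeminorm_eq_zero [Fact (1 ≤ p)] {x : EuclideanSpace ℝ (Fin n)}
    (h : pSeminorm n p x = 0) : x = 0 := by
  have h' : ‖WithLp.toLp p (WithLp.ofLp x)‖ = 0 := h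
  have := norm_eq_zero.1 h'
  ext i
  have := congrArg (fun z : PiLp p (fun _ : Fin n => ℝ) => z i) this
  simpa using this

lemma abs_apply_le_pSeminorm [Fact (1 ≤ p)] (x : EuclideanSpace ℝ (Fin n)) (i : Fin n) :
    |x i| ≤ pSeminorm n p x :=
  PiLp.norm_apply_le (p := p) (WithLp.toLp p (WithLp.ofLp x)) i

lemma pNorm_eq_sum {r : ℝ} (hr : 0 < r) (x : EuclideanSpace ℝ (Fin n)) :
    pNorm (ENNReal.ofReal r) x = (∑ i, |x i| ^ r) ^ (1 / r) := by
  have h : (ENNReal.ofReal r).toReal = r := ENNReal.toReal_ofReal hr.le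
  unfold pNorm
  rw [PiLp.norm_eq_sum (by rw [h]; exact hr), h]
  rfl

lemma pNorm_rpow_eq_sum {r : ℝ} (hr : 0 < r) (x : EuclideanSpace ℝ (Fin n)) :
    pNorm (ENNReal.ofReal r) x ^ r = ∑ i, |x i| ^ r := by
  have h0 : 0 ≤ ∑ i, |x i| ^ r :=
    Finset.sum_nonneg fun i _ => Real.rpow_nonneg (abs_nonneg _) _
  rw [pNorm_eq_sum hr, ← Real.rpow_mul h0, one_div_mul_cancel hr.ne', Real.rpow_one]

lemma isCompact_pSeminorm_le [Fact (1 ≤ p)] (R : ℝ) :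
    IsCompact {x : EuclideanSpace ℝ (Fin n) | pSeminorm n p x ≤ R} := by
  have h := (((PiLp.homeomorph 2 fun _ : Fin n => ℝ).trans
    (PiLp.homeomorph p fun _ : Fin n => ℝ).symm).isCompact_preimage).2
    (isCompact_closedBall (0 : PiLp p fun _ : Fin n => ℝ) R)
  convert h using 1
  ext x
  simp only [Set.mem_ofPred_eq, Set.mem_preimage, mem_closedBall_zero_iff]
  rfl

/-- Second-order upper bound for the `r`-th power of the `r`-norm. -/
lemma exists_pSeminorm_add_rpow_le {r : ℝ} (hr : 2 ≤ r) [Fact (1 ≤ ENNReal.ofReal r)]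
    (h : EuclideanSpace ℝ (Fin n)) :
    ∃ g : EuclideanSpace ℝ (Fin n), ∀ (d : EuclideanSpace ℝ (Fin n)) (A B : ℝ),
      0 < A → 0 < B → pSeminorm n (ENNReal.ofReal r) h + B ≤ A →
      pSeminorm n (ENNReal.ofReal r) d ≤ B →
      pSeminorm n (ENNReal.ofReal r) (h + d) ^ r ≤ pSeminorm n (ENNReal.ofReal r) h ^ r
        + inner ℝ g d + r * (r - 1) * (A ^ (r - 2) * B ^ 2) := by
  have hr0 : 0 < r := by linarith
  refine ⟨WithLp.toLp 2 fun i => r * (|h i| ^ (r - 2) * h i), fun d A B hA hB hhA hdB => ?_⟩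
  simp only [pSeminorm_apply] at *
  have hi : inner ℝ (WithLp.toLp 2 fun i => r * (|h i| ^ (r - 2) * h i)) d
      = ∑ i, r * (|h i| ^ (r - 2) * h i) * d i := by
    simp [PiLp.inner_apply, mul_comm]
  have hd : ∑ i, |d i| ^ r ≤ B ^ r := by
    rw [← pNorm_rpow_eq_sum hr0]
    exact Real.rpow_le_rpow (norm_nonneg _) hdB hr0.le
  have hh : ∑ i, (|h i| + |d i|) ^ r ≤ A ^ r := by
    have hm := Real.Lp_add_le Finset.univ (fun i => |h i|) (fun i => |d i|)
      (by linarith : 1 ≤ r)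
    simp only [abs_abs] at hm
    rw [← pNorm_eq_sum hr0, ← pNorm_eq_sum hr0] at hm
    have hs : 0 ≤ ∑ i, |(|h i| + |d i|)| ^ r :=
      Finset.sum_nonneg fun i _ => Real.rpow_nonneg (abs_nonneg _) _
    have := Real.rpow_le_rpow (Real.rpow_nonneg hs _)
      (hm.trans (by linarith : _ ≤ A)) hr0.le
    rw [← Real.rpow_mul hs, one_div_mul_cancel hr0.ne', Real.rpow_one] at this
    refine le_trans (le_of_eq (Finset.sum_congr rfl fun i _ => ?_)) this
    rw [abs_of_nonneg (by positivity : 0 ≤ |h i| + |d i|)]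
  have hH := sum_rpow_sub_two_mul_sq_le Finset.univ hr (u := fun i => |h i| + |d i|)
    (v := fun i => |d i|) (fun i => by positivity) (fun i => abs_nonneg _) hA hB hh hd
  simp only [sq_abs] at hH
  rw [pNorm_rpow_eq_sum hr0, pNorm_rpow_eq_sum hr0, hi]
  calc ∑ i, |(h + d) i| ^ r
      ≤ ∑ i, (|h i| ^ r + r * (|h i| ^ (r - 2) * h i) * d i
        + r * (r - 1) * ((|h i| + |d i|) ^ (r - 2) * d i ^ 2)) :=
        Finset.sum_le_sum fun i _ => abs_add_rpow_le hr (h i) (d i)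
    _ = ∑ i, |h i| ^ r + ∑ i, r * (|h i| ^ (r - 2) * h i) * d i
        + r * (r - 1) * ∑ i, (|h i| + |d i|) ^ (r - 2) * d i ^ 2 := by
        rw [Finset.sum_add_distrib, Finset.sum_add_distrib, ← Finset.mul_sum]
    _ ≤ _ := by
        have : 0 ≤ r * (r - 1) := mul_nonneg hr0.le (by linarith)
        gcongr

end pNorm

/-! ### Gradients of convex functions with quadratic upper models. -/

section Gradient

variable {E : Type*} [NormedAddCommGroup E] [InnerProductSpace ℝ E]

/-- For a convex function, a local quadratic upper model is tangent from below. -/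
lemma ConvexOn.add_inner_le_of_quadratic_upper {F : E → ℝ} (hF : ConvexOn ℝ Set.univ F)
    {a : Seminorm ℝ E} {δ M : ℝ} (hδ : 0 < δ) (hM : 0 ≤ M) {x g : E}
    (hg : ∀ d, a d ≤ δ → F (x + d) ≤ F x + inner ℝ g d + M * a d ^ 2) (d : E) :
    F x + inner ℝ g d ≤ F (x + d) := by
  refine le_of_forall_pos_le_add fun ε hε => ?_
  have had := apply_nonneg a d
  obtain ⟨t, ht, ht1, htδ, htε⟩ : ∃ t : ℝ, 0 < t ∧ t ≤ 1 ∧ t * a d ≤ δ ∧ t * (M * a d ^ 2) ≤ ε := by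
    refine ⟨min 1 (min (δ / (a d + 1)) (ε / (M * a d ^ 2 + 1))), by positivity, min_le_left _ _,
      ?_, ?_⟩
    · calc _ ≤ δ / (a d + 1) * a d := by
            gcongr; exact (min_le_right _ _).trans (min_le_left _ _)
        _ ≤ δ := by rw [div_mul_eq_mul_div, div_le_iff₀ (by positivity)]; nlinarith
    · calc _ ≤ ε / (M * a d ^ 2 + 1) * (M * a d ^ 2) := by
            gcongr; exact (min_le_right _ _).trans (min_le_right _ _)
        _ ≤ ε := by
            have : 0 ≤ M * a d ^ 2 := by positivity
            rw [div_mul_eq_mul_div, div_le_iff₀ (by positivity)]; nlinarith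
  -- The point `x` lies between `x - t • d` and `x + d`: the upper model at the first and convexity
  -- give the claim up to an error `t * M * a d ^ 2`.
  have h1 := hg (-(t • d)) (by
    rw [map_neg_eq_map, map_smul_eq_mul, Real.norm_of_nonneg ht.le]; exact htδ)
  rw [map_neg_eq_map, map_smul_eq_mul, Real.norm_of_nonneg ht.le, inner_neg_right,
    inner_smul_right] at h1
  have h2 := hF.2 (Set.mem_univ (x + -(t • d))) (Set.mem_univ (x + d))
    (show 0 ≤ 1 / (1 + t) by positivity) (show 0 ≤ t / (1 + t) by positivity) (by field_simp)
  have h3 : (1 / (1 + t)) • (x + -(t • d)) + (t / (1 + t)) • (x + d) = x := by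
    match_scalars <;> field_simp
    ring
  rw [h3, smul_eq_mul, smul_eq_mul, div_mul_eq_mul_div, div_mul_eq_mul_div, ← add_div,
    le_div_iff₀ (by positivity)] at h2
  have h4 : t * (F x + inner ℝ g d) ≤ t * (F (x + d) + ε) := by
    have := mul_le_mul_of_nonneg_left htε ht.le
    nlinarith
  exact le_of_mul_le_mul_left h4 ht

variable [CompleteSpace E]

/-- A convex Lipschitz function with local quadratic upper models is continuously differentiable,
with Lipschitz gradient. -/
theorem ConvexOn.contDiff_one_and_inner_gradient_sub_le {F : E → ℝ} (hF : ConvexOn ℝ Set.univ F)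
    {a : Seminorm ℝ E} (ha : Continuous a) (ha0 : ∀ x, a x = 0 → x = 0)
    (hlip : ∀ x y, |F x - F y| ≤ a (x - y)) {δ M : ℝ} (hδ : 0 < δ) (hM : 0 ≤ M) (hMδ : 2 ≤ M * δ)
    (hup : ∀ x, ∃ g, ∀ d, a d ≤ δ → F (x + d) ≤ F x + inner ℝ g d + M * a d ^ 2) :
    ContDiff ℝ 1 F ∧ ∀ x y d,
      inner ℝ (gradient F x - gradient F y) d ≤ 4 * M * a (x - y) * a d := by
  choose g hg using hup
  have hlow : ∀ x d, F x + inner ℝ (g x) d ≤ F (x + d) := fun x d =>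
    hF.add_inner_le_of_quadratic_upper hδ hM (hg x) d
  have hupper : ∀ x d, F (x + d) ≤ F x + inner ℝ (g x) d + M * a d ^ 2 := fun x d => by
    rcases le_total (a d) δ with h | h
    · exact hg x d h
    -- Far from `x`, the Lipschitz bound alone leaves an error of at most `2 * a d ≤ M * δ * a d ≤ M
    -- * a d ^ 2`.
    · have h1 := hlow x (-d)
      have h2 := (abs_le.1 (hlip x (x + -d))).1
      have h3 := (abs_le.1 (hlip (x + d) x)).2
      rw [show x - (x + -d) = d by abel] at h2
      rw [show x + d - x = d by abel] at h3
      rw [inner_neg_right] at h1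
      nlinarith [mul_le_mul_of_nonneg_left h hM]
  obtain ⟨K, hK, hKa⟩ := Seminorm.bound_of_continuous_normedSpace a ha
  have hgrad : ∀ x, HasGradientAt F (g x) x := fun x => by
    rw [hasGradientAt_iff_isLittleO_nhds_zero]
    have hO : (fun h => F (x + h) - F x - inner ℝ (g x) h) =O[𝓝 0] fun h : E => ‖h‖ ^ 2 := by
      refine Asymptotics.IsBigO.of_bound (M * K ^ 2) (Filter.Eventually.of_forall fun h => ?_)
      rw [Real.norm_of_nonneg (by linarith [hlow x h]), Real.norm_of_nonneg (by positivity)]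
      have h1 := hupper x h
      have h2 : a h ^ 2 ≤ (K * ‖h‖) ^ 2 := pow_le_pow_left₀ (apply_nonneg a h) (hKa h) 2
      have h3 := mul_le_mul_of_nonneg_left h2 hM
      nlinarith
    exact hO.trans_isLittleO (Asymptotics.isLittleO_norm_pow_id one_lt_two)
  have hgr : ∀ x, gradient F x = g x := fun x => (hgrad x).gradient
  have hmain : ∀ x y d, inner ℝ (g x - g y) d ≤ M * (a (x - y) + a d) ^ 2 := fun x y d => by
    have h1 := hlow x d
    have h2 := hlow y (x - y)
    have h3 := hupper y (x - y + d)
    rw [show y + (x - y) = x by abel] at h2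
    rw [show y + (x - y + d) = x + d by abel, inner_add_right] at h3
    have h4 : a (x - y + d) ^ 2 ≤ (a (x - y) + a d) ^ 2 :=
      pow_le_pow_left₀ (apply_nonneg a _) (map_add_le_add a _ _) 2
    have h5 := mul_le_mul_of_nonneg_left h4 hM
    rw [inner_sub_left]
    linarith
  have hfin : ∀ x y d, inner ℝ (g x - g y) d ≤ 4 * M * a (x - y) * a d := fun x y d => by
    rcases eq_or_ne x y with rfl | hxy
    · simp
    rcases eq_or_ne d 0 with rfl | hd
    · simp
    have hs : 0 < a (x - y) := (apply_nonneg a _).lt_of_ne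
      fun h => hxy (sub_eq_zero.1 (ha0 _ h.symm))
    have hd' : 0 < a d := (apply_nonneg a _).lt_of_ne fun h => hd (ha0 _ h.symm)
    -- Rescaling `d` to have the same size as `x - y` balances the two terms of `hmain`, whence the
    -- factor 4.
    have h := hmain x y ((a (x - y) / a d) • d)
    rw [inner_smul_right, map_smul_eq_mul, Real.norm_of_nonneg (by positivity),
      div_mul_cancel₀ _ hd'.ne', div_mul_eq_mul_div, div_le_iff₀ hd'] at h
    have h2 : a (x - y) * inner ℝ (g x - g y) d ≤ a (x - y) * (4 * M * a (x - y) * a d) := by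
      linarith
    exact le_of_mul_le_mul_left h2 hs
  refine ⟨contDiff_one_iff_fderiv.2 ⟨fun x => (hgrad x).hasFDerivAt.differentiableAt, ?_⟩,
    fun x y d => by rw [hgr, hgr]; exact hfin x y d⟩
  have hfd : fderiv ℝ F = fun x => InnerProductSpace.toDual ℝ E (g x) :=
    funext fun x => (hgrad x).hasFDerivAt.fderiv
  rw [hfd]
  refine (InnerProductSpace.toDual ℝ E).continuous.comp ?_
  refine (LipschitzWith.of_dist_le_mul (K := ⟨4 * M * K ^ 2, by positivity⟩)
    fun x y => ?_).continuous
  rw [dist_eq_norm, dist_eq_norm]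
  rcases eq_or_ne (g x - g y) 0 with h0 | h0
  · rw [h0, norm_zero]; exact mul_nonneg (NNReal.coe_nonneg _) (norm_nonneg _)
  have h := hfin x y (g x - g y)
  rw [real_inner_self_eq_norm_sq] at h
  have h2 : a (x - y) * a (g x - g y) ≤ K * ‖x - y‖ * (K * ‖g x - g y‖) :=
    mul_le_mul (hKa _) (hKa _) (apply_nonneg a _) (by positivity)
  have h3 := mul_le_mul_of_nonneg_left h2 (by positivity : 0 ≤ 4 * M)
  refine le_of_mul_le_mul_right ?_ (norm_pos_iff.2 h0)
  change ‖g x - g y‖ * ‖g x - g y‖ ≤ 4 * M * K ^ 2 * ‖x - y‖ * ‖g x - g y‖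
  linarith

end Gradient

/-! ### Duality and comparison of norms. -/

section pNorm

variable {n : ℕ} {p : ℝ≥0∞}

lemma pNorm_top_le {x : EuclideanSpace ℝ (Fin n)} {A : ℝ} (hA : 0 ≤ A) (h : ∀ i, |x i| ≤ A) :
    pNorm ∞ x ≤ A := by
  unfold pNorm
  rw [PiLp.norm_toLp]
  exact (pi_norm_le_iff_of_nonneg hA).2 h

/-- The `q`-norm is bounded by the support function of the unit ball of the dual `p`-norm. -/
lemma pNorm_conjExponent_le (hp : 2 ≤ p) {v : EuclideanSpace ℝ (Fin n)} {B : ℝ}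
    (h : ∀ d, pNorm p d ≤ 1 → inner ℝ v d ≤ B) : pNorm (ENNReal.conjExponent p) v ≤ B := by
  rcases eq_or_ne p ∞ with rfl | hpt
  · have e : ENNReal.conjExponent ∞ = ENNReal.ofReal 1 := by simp [ENNReal.conjExponent]
    have h1 := h (WithLp.toLp 2 fun i => (SignType.sign (v i) : ℝ))
      (pNorm_top_le zero_le_one fun i => by
        rcases lt_trichotomy (v i) 0 with hi | hi | hi <;> simp [hi])
    rw [e, pNorm_eq_sum one_pos]
    simpa [PiLp.inner_apply] using h1
  · have hP2 : 2 ≤ p.toReal := by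
      simpa using ENNReal.toReal_mono hpt hp
    set P := p.toReal with hP
    have hpP : p = ENNReal.ofReal P := (ENNReal.ofReal_toReal hpt).symm
    have hc : P.HolderConjugate P.conjExponent := .conjExponent (by linarith)
    have hQ : ENNReal.conjExponent p = ENNReal.ofReal P.conjExponent := by
      rw [ENNReal.conjExponent, hpP, ← ENNReal.ofReal_one,
        ← ENNReal.ofReal_sub _ zero_le_one, ← ENNReal.ofReal_inv_of_pos (by linarith),
        ← ENNReal.ofReal_add zero_le_one (inv_nonneg.2 (by linarith))]
      congr 1
      have : P - 1 ≠ 0 := by linarith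
      rw [Real.conjExponent]; field_simp; ring
    -- The extremal vector in Hölder's inequality for `|v i|`; the signs of `v` are restored in the
    -- test vector.
    obtain ⟨g, hg, hgv⟩ := (NNReal.isGreatest_Lp Finset.univ (fun i => ‖v i‖₊) hc.symm).1
    have h1 := h (WithLp.toLp 2 fun i => (SignType.sign (v i) : ℝ) * g i) (by
      rw [hpP, pNorm_eq_sum hc.pos]
      refine Real.rpow_le_one (Finset.sum_nonneg fun i _ => Real.rpow_nonneg (abs_nonneg _) _) ?_
        (one_div_nonneg.2 hc.nonneg)
      refine le_trans (Finset.sum_le_sum fun i _ => ?_)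
        (show ((∑ i, (g i : ℝ) ^ P : ℝ)) ≤ 1 by exact_mod_cast hg)
      refine Real.rpow_le_rpow (abs_nonneg _) ?_ hc.nonneg
      simp only [abs_mul, NNReal.abs_eq]
      refine mul_le_of_le_one_left (g i).2 ?_
      rcases lt_trichotomy (v i) 0 with hi | hi | hi <;> simp [hi])
    rw [hQ, pNorm_eq_sum hc.symm.pos]
    have hgv' := congrArg NNReal.toReal hgv
    push_cast at hgv'
    simp only [Real.norm_eq_abs] at hgv'
    rw [← hgv']
    refine le_trans (le_of_eq ?_) h1
    rw [PiLp.inner_apply]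
    refine Finset.sum_congr rfl fun i _ => ?_
    simp only [RCLike.inner_apply, conj_trivial]
    rw [← sign_mul_self (v i)]; ring

lemma pNorm_le_pNorm_ofReal {r : ℝ} (hr : 1 ≤ r) (hrp : ENNReal.ofReal r ≤ p)
    (x : EuclideanSpace ℝ (Fin n)) : pNorm p x ≤ pNorm (ENNReal.ofReal r) x := by
  have hr0 : 0 < r := by linarith
  have : Fact (1 ≤ ENNReal.ofReal r) := ⟨by simpa using hr⟩
  have hA : 0 ≤ pNorm (ENNReal.ofReal r) x := norm_nonneg _
  have hx : ∀ i, |x i| ≤ pNorm (ENNReal.ofReal r) x := abs_apply_le_pSeminorm x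
  rcases eq_or_ne p ∞ with rfl | hpt
  · exact pNorm_top_le hA hx
  · have hrP : r ≤ p.toReal := (ENNReal.ofReal_le_iff_le_toReal hpt).1 hrp
    have hP0 : 0 < p.toReal := by linarith
    rw [← ENNReal.ofReal_toReal hpt, pNorm_eq_sum hP0]
    rw [one_div, Real.rpow_inv_le_iff_of_pos
      (Finset.sum_nonneg fun i _ => Real.rpow_nonneg (abs_nonneg _) _) hA hP0]
    have hs : ∀ y : ℝ, 0 ≤ y → y ^ p.toReal = y ^ (p.toReal - r) * y ^ r := fun y hy => by
      rw [← Real.rpow_add_of_nonneg hy (by linarith) hr0.le, sub_add_cancel]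
    rw [hs _ hA, pNorm_rpow_eq_sum hr0, Finset.mul_sum]
    refine Finset.sum_le_sum fun i _ => ?_
    rw [hs _ (abs_nonneg _)]
    gcongr
    exact hx i

/-- Each coordinate is at most the `p`-norm, and the resulting factor `n ^ (1 / r)` is at most `e <
3` once `r ≥ log n`. -/
lemma pNorm_ofReal_le_mul_pNorm [Fact (1 ≤ p)] {r : ℝ} (hr : 1 ≤ r) (hn : 0 < n)
    (hnr : Real.log n ≤ r) (x : EuclideanSpace ℝ (Fin n)) :
    pNorm (ENNReal.ofReal r) x ≤ 3 * pNorm p x := by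
  have hr0 : 0 < r := by linarith
  have hA : 0 ≤ pNorm p x := norm_nonneg _
  have hx : ∀ i, |x i| ≤ pNorm p x := abs_apply_le_pSeminorm x
  rw [pNorm_eq_sum hr0]
  have h1 : ∑ i, |x i| ^ r ≤ n * pNorm p x ^ r := by
    calc ∑ i, |x i| ^ r ≤ ∑ _i : Fin n, pNorm p x ^ r :=
          Finset.sum_le_sum fun i _ => Real.rpow_le_rpow (abs_nonneg _) (hx i) hr0.le
      _ = _ := by simp
  have h2 : (n : ℝ) ≤ 3 ^ r := by
    calc (n : ℝ) = Real.exp (Real.log n) := (Real.exp_log (by exact_mod_cast hn)).symm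
      _ ≤ Real.exp r := Real.exp_le_exp.2 hnr
      _ = Real.exp 1 ^ r := (Real.exp_one_rpow r).symm
      _ ≤ 3 ^ r := Real.rpow_le_rpow (Real.exp_pos 1).le
          (by linarith [Real.exp_one_lt_d9]) hr0.le
  have h3 : ∑ i, |x i| ^ r ≤ (3 * pNorm p x) ^ r := by
    rw [Real.mul_rpow (by norm_num) hA]
    exact h1.trans (mul_le_mul_of_nonneg_right h2 (Real.rpow_nonneg hA r))
  calc _ ≤ ((3 * pNorm p x) ^ r) ^ (1 / r) := Real.rpow_le_rpow
        (Finset.sum_nonneg fun i _ => Real.rpow_nonneg (abs_nonneg _) _) h3 (by positivity)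
    _ = 3 * pNorm p x := by
        rw [← Real.rpow_mul (by positivity), mul_one_div_cancel hr0.ne', Real.rpow_one]

/-- The `p`-norm is within a factor `3` of an `r`-norm with `r` of order `min p (log n)`. -/
lemma exists_exponent_pNorm_equiv (hn : 2 ≤ n) (hp : 2 ≤ p) :
    ∃ r : ℝ, 2 ≤ r ∧ r ≤ 4 * (min p (ENNReal.ofReal (Real.log n))).toReal ∧
      ∀ x : EuclideanSpace ℝ (Fin n), pNorm p x ≤ pNorm (ENNReal.ofReal r) x ∧
        pNorm (ENNReal.ofReal r) x ≤ 3 * pNorm p x := by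
  have : Fact (1 ≤ p) := ⟨le_trans (by norm_num) hp⟩
  have hl2 : Real.log 2 ≤ Real.log n := Real.log_le_log (by norm_num) (by exact_mod_cast hn)
  have hl : 1 / 2 ≤ Real.log n := by linarith [Real.log_two_gt_d9]
  -- The exponent is `min p (max 2 (log n))`; the factor 4 absorbs the floor 2, since `log n ≥ 1 /
  -- 2`.
  have hm : max 2 (Real.log n) ≤ 4 * Real.log n := max_le (by linarith) (by linarith)
  have hm2 : 2 ≤ max 2 (Real.log n) := le_max_left _ _
  rcases le_total p (ENNReal.ofReal (max 2 (Real.log n))) with h | h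
  · have hpt : p ≠ ∞ := ne_top_of_le_ne_top ENNReal.ofReal_ne_top h
    have hP2 : 2 ≤ p.toReal := by simpa using ENNReal.toReal_mono hpt hp
    refine ⟨p.toReal, hP2, ?_, fun x => ?_⟩
    · have := ENNReal.toReal_mono ENNReal.ofReal_ne_top h
      rw [ENNReal.toReal_ofReal (by linarith)] at this
      rw [ENNReal.toReal_min hpt ENNReal.ofReal_ne_top, ENNReal.toReal_ofReal (by linarith)]
      rcases min_choice p.toReal (Real.log n) with h' | h' <;> rw [h'] <;> linarith
    · rw [ENNReal.ofReal_toReal hpt]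
      have : 0 ≤ pNorm p x := norm_nonneg _
      exact ⟨le_rfl, by linarith⟩
  · refine ⟨max 2 (Real.log n), hm2, ?_, fun x =>
      ⟨pNorm_le_pNorm_ofReal (by linarith) h x,
        pNorm_ofReal_le_mul_pNorm (by linarith) (by omega) (le_max_right _ _) x⟩⟩
    have h' : ENNReal.ofReal (Real.log n) ≤ p :=
      (ENNReal.ofReal_le_ofReal (le_max_right _ _)).trans h
    rw [min_eq_right h', ENNReal.toReal_ofReal (by linarith)]
    exact hm

end pNorm

/-! ### Inf-convolution: locality, convexity, and confinement of minimizers. -/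

section InfConvolution

variable {E : Type*} [NormedAddCommGroup E] [NormedSpace ℝ E]

/-- The inf-convolution of `f` with `c ρ ^ r`, restricted to the ball `ρ ≤ R`. -/
noncomputable def infSmoothing (ρ : Seminorm ℝ E) (r c R : ℝ) (f : E → ℝ) (x : E) : ℝ :=
  sInf ((fun h => f (x + h) + c * ρ h ^ r) '' {h | ρ h ≤ R})

variable {ρ a : Seminorm ℝ E} {r c R : ℝ} {f : E → ℝ}

lemma continuous_of_abs_sub_le_seminorm (ha : Continuous a) (hf : ∀ x y, |f x - f y| ≤ a (x - y)) :
    Continuous f := by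
  obtain ⟨K, hK, hKa⟩ := Seminorm.bound_of_continuous_normedSpace a ha
  refine (LipschitzWith.of_dist_le_mul (K := ⟨K, hK.le⟩) fun x y => ?_).continuous
  rw [Real.dist_eq, dist_eq_norm]
  exact (hf x y).trans (hKa _)

lemma exists_infSmoothing_eq (hρ : Continuous ρ) (hρK : IsCompact {h | ρ h ≤ R}) (hR : 0 ≤ R)
    (hr : 0 ≤ r) (hf : Continuous f) (x : E) :
    ∃ h, ρ h ≤ R ∧ infSmoothing ρ r c R f x = f (x + h) + c * ρ h ^ r ∧
      ∀ h', ρ h' ≤ R → infSmoothing ρ r c R f x ≤ f (x + h') + c * ρ h' ^ r := by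
  have hc : ContinuousOn (fun h => f (x + h) + c * ρ h ^ r) {h | ρ h ≤ R} :=
    ((hf.comp (continuous_const.add continuous_id)).add
      (continuous_const.mul (hρ.rpow_const fun _ => Or.inr hr))).continuousOn
  have hne : {h | ρ h ≤ R}.Nonempty := ⟨0, by simpa using hR⟩
  obtain ⟨h, hh, he⟩ := hρK.exists_sInf_image_eq hne hc
  exact ⟨h, hh, he, fun h' hh' =>
    csInf_le (hρK.bddBelow_image hc) (Set.mem_image_of_mem _ hh')⟩

lemma infSmoothing_eqOn (ha : Continuous a) (haρ : ∀ x, a x ≤ ρ x) {χ : ℝ} (hRχ : R < χ) (x : E) :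
    ∃ U ∈ 𝓝 x, ∀ f g : E → ℝ, Set.EqOn f g {y | a (y - x) ≤ χ} →
      Set.EqOn (infSmoothing ρ r c R f) (infSmoothing ρ r c R g) U := by
  refine ⟨{y | a (y - x) < χ - R}, ?_, fun f g hfg y hy => ?_⟩
  · refine (isOpen_lt (ha.comp (continuous_id.sub continuous_const)) continuous_const).mem_nhds ?_
    simpa using hRχ
  · refine congrArg sInf (Set.image_congr fun h hh => ?_)
    have hmem : a (y + h - x) ≤ χ := by
      have h1 : a (y - x) < χ - R := hy
      have h2 : ρ h ≤ R := hh
      have h3 := map_add_le_add a (y - x) h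
      rw [show y - x + h = y + h - x by abel] at h3
      linarith [haρ h]
    rw [hfg hmem]

/-- The same convex combination of the minimizers at the two endpoints is an admissible competitor
at the intermediate point. -/
lemma convexOn_infSmoothing (hρ : Continuous ρ) (hρK : IsCompact {h | ρ h ≤ R}) (hR : 0 ≤ R)
    (hr : 1 ≤ r) (hc : 0 ≤ c) (hf : Continuous f) (hfc : ConvexOn ℝ Set.univ f) :
    ConvexOn ℝ Set.univ (infSmoothing ρ r c R f) := by
  refine ⟨convex_univ, fun x _ y _ s t hs ht hst => ?_⟩
  obtain ⟨h, hh, he, -⟩ := exists_infSmoothing_eq (c := c) hρ hρK hR (by linarith : 0 ≤ r) hf x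
  obtain ⟨k, hk, ke, -⟩ := exists_infSmoothing_eq (c := c) hρ hρK hR (by linarith : 0 ≤ r) hf y
  obtain ⟨-, -, -, hmin⟩ :=
    exists_infSmoothing_eq (c := c) hρ hρK hR (by linarith : 0 ≤ r) hf (s • x + t • y)
  have hsub : ρ (s • h + t • k) ≤ s * ρ h + t * ρ k := by
    refine (map_add_le_add ρ _ _).trans (le_of_eq ?_)
    rw [map_smul_eq_mul, map_smul_eq_mul, Real.norm_of_nonneg hs, Real.norm_of_nonneg ht]
  have h1 := hmin (s • h + t • k) (hsub.trans (by
    calc s * ρ h + t * ρ k ≤ s * R + t * R := by gcongr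
      _ = R := by rw [← add_mul, hst, one_mul]))
  have h2 := hfc.2 (Set.mem_univ (x + h)) (Set.mem_univ (y + k)) hs ht hst
  rw [show s • (x + h) + t • (y + k) = s • x + t • y + (s • h + t • k) by
    rw [smul_add, smul_add]; abel] at h2
  have h3 : ρ (s • h + t • k) ^ r ≤ s * ρ h ^ r + t * ρ k ^ r :=
    (Real.rpow_le_rpow (apply_nonneg ρ _) hsub (by linarith)).trans
      ((convexOn_rpow hr).2 (apply_nonneg ρ h) (apply_nonneg ρ k) hs ht hst)
  have h4 := mul_le_mul_of_nonneg_left h3 hc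
  rw [he, ke]
  simp only [smul_eq_mul] at *
  linarith

lemma abs_infSmoothing_sub_le (hρ : Continuous ρ) (hρK : IsCompact {h | ρ h ≤ R}) (hR : 0 ≤ R)
    (hr : 0 ≤ r) (ha : Continuous a) (hf : ∀ x y, |f x - f y| ≤ a (x - y)) (x y : E) :
    |infSmoothing ρ r c R f x - infSmoothing ρ r c R f y| ≤ a (x - y) := by
  have hfc := continuous_of_abs_sub_le_seminorm ha hf
  have key : ∀ x y, infSmoothing ρ r c R f x - infSmoothing ρ r c R f y ≤ a (x - y) :=
    fun x y => by
      obtain ⟨-, -, -, hmin⟩ := exists_infSmoothing_eq (c := c) hρ hρK hR hr hfc x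
      obtain ⟨k, hk, ke, -⟩ := exists_infSmoothing_eq (c := c) hρ hρK hR hr hfc y
      have h1 := hmin k hk
      have h2 := (abs_le.1 (hf (x + k) (y + k))).2
      rw [add_sub_add_right_eq_sub] at h2
      linarith
  exact abs_sub_le_iff.2 ⟨key x y, by rw [map_sub_rev]; exact key y x⟩

lemma infSmoothing_bounds (hρ : Continuous ρ) (hρK : IsCompact {h | ρ h ≤ R}) (hR : 0 ≤ R)
    (hr : 0 < r) (hc : 0 ≤ c) (ha : Continuous a) (haρ : ∀ x, a x ≤ ρ x)
    (hf : ∀ x y, |f x - f y| ≤ a (x - y)) (x : E) :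
    infSmoothing ρ r c R f x ≤ f x ∧ f x - R ≤ infSmoothing ρ r c R f x := by
  have hfc := continuous_of_abs_sub_le_seminorm ha hf
  obtain ⟨h, hh, he, hmin⟩ := exists_infSmoothing_eq (c := c) hρ hρK hR hr.le hfc x
  constructor
  · have := hmin 0 (by simpa using hR)
    simpa [Real.zero_rpow hr.ne'] using this
  · have h1 := (abs_le.1 (hf (x + h) x)).1
    rw [add_sub_cancel_left] at h1
    have : 0 ≤ c * ρ h ^ r := mul_nonneg hc (Real.rpow_nonneg (apply_nonneg ρ h) r)
    rw [he]
    linarith [haρ h]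

lemma one_sub_inv_rpow_le {r : ℝ} (hr : 1 ≤ r) : (1 - r⁻¹) ^ r ≤ 1 / 2 := by
  have h0 : 0 ≤ 1 - r⁻¹ := sub_nonneg.2 (inv_le_one_of_one_le₀ hr)
  calc (1 - r⁻¹) ^ r ≤ Real.exp (-r⁻¹) ^ r :=
        Real.rpow_le_rpow h0 (by linarith [Real.add_one_le_exp (-r⁻¹)]) (by linarith)
    _ = (Real.exp 1)⁻¹ := by
        rw [← Real.exp_mul, neg_mul, inv_mul_cancel₀ (by linarith), Real.exp_neg]
    _ ≤ 1 / 2 := by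
        rw [one_div]
        exact inv_anti₀ (by norm_num) (by linarith [Real.exp_one_gt_d9])

lemma one_add_inv_rpow_le {r s : ℝ} (hr : 0 < r) (hs : 0 ≤ s) (hsr : s ≤ r) :
    (1 + r⁻¹) ^ s ≤ 3 := by
  have hi : 0 < r⁻¹ := inv_pos.2 hr
  calc (1 + r⁻¹) ^ s ≤ Real.exp r⁻¹ ^ s :=
        Real.rpow_le_rpow (by linarith) (by linarith [Real.add_one_le_exp r⁻¹]) hs
    _ = Real.exp (r⁻¹ * s) := by rw [← Real.exp_mul]
    _ ≤ Real.exp 1 := Real.exp_le_exp.2 (by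
        rw [inv_mul_le_iff₀ hr]; linarith)
    _ ≤ 3 := by linarith [Real.exp_one_lt_d9]

/-- The minimizers in the inf-convolution lie in the smaller ball `ρ ≤ R`. -/
lemma seminorm_le_of_isMin (hr : 1 < r) (hR : 0 < R) (haρ : ∀ x, a x ≤ ρ x)
    (hf : ∀ x y, |f x - f y| ≤ a (x - y)) {x h : E} (hh : ρ h ≤ 2 * R)
    (hmin : ∀ h', ρ h' ≤ 2 * R → f (x + h) + 2 / (r * R ^ (r - 1)) * ρ h ^ r
      ≤ f (x + h') + 2 / (r * R ^ (r - 1)) * ρ h' ^ r) : ρ h ≤ R := by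
  have hr0 : 0 < r := by linarith
  by_contra! hlt
  have hρ0 : 0 < ρ h := hR.trans hlt
  have hi : 0 < r⁻¹ := inv_pos.2 hr0
  have h0 : 0 ≤ 1 - r⁻¹ := sub_nonneg.2 (inv_le_one_of_one_le₀ hr.le)
  have e : ρ ((1 - r⁻¹) • h) = (1 - r⁻¹) * ρ h := by
    rw [map_smul_eq_mul, Real.norm_of_nonneg h0]
  -- Shrinking `h` by `1 - 1 / r` raises `f` by at most `ρ h / r` but at least halves the penalty,
  -- saving at least `(ρ h / r) * (ρ h / R) ^ (r - 1)`. This exceeds `ρ h / r` when `ρ h > R`.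
  have h1 := hmin ((1 - r⁻¹) • h) (by rw [e]; nlinarith)
  have h2 := (abs_le.1 (hf (x + (1 - r⁻¹) • h) (x + h))).2
  rw [show x + (1 - r⁻¹) • h - (x + h) = -(r⁻¹ • h) by rw [sub_smul, one_smul]; abel,
    map_neg_eq_map, map_smul_eq_mul, Real.norm_of_nonneg hi.le] at h2
  rw [e, Real.mul_rpow h0 hρ0.le] at h1
  have hRr : 0 < R ^ (r - 1) := Real.rpow_pos_of_pos hR _
  have hpow : R ^ (r - 1) < ρ h ^ (r - 1) := Real.rpow_lt_rpow hR.le hlt (by linarith)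
  have hs : ρ h ^ r = ρ h ^ (r - 1) * ρ h := by
    rw [← Real.rpow_add_one hρ0.ne', sub_add_cancel]
  have h3 : 2 / (r * R ^ (r - 1)) * ((1 - r⁻¹) ^ r * ρ h ^ r)
      ≤ 2 / (r * R ^ (r - 1)) * (1 / 2 * ρ h ^ r) := by
    have := one_sub_inv_rpow_le hr.le
    gcongr
  have h4 : 2 / (r * R ^ (r - 1)) * ρ h ^ r - 2 / (r * R ^ (r - 1)) * (1 / 2 * ρ h ^ r)
      ≤ r⁻¹ * ρ h := by
    have := mul_le_mul_of_nonneg_left (haρ h) hi.le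
    linarith
  have h5 : 2 / (r * R ^ (r - 1)) * ρ h ^ r - 2 / (r * R ^ (r - 1)) * (1 / 2 * ρ h ^ r)
      = r⁻¹ * ρ h * (ρ h ^ (r - 1) / R ^ (r - 1)) := by
    rw [hs]; field_simp; ring
  rw [h5] at h4
  have h6 : 1 < ρ h ^ (r - 1) / R ^ (r - 1) := (one_lt_div hRr).2 hpow
  nlinarith [mul_pos hi hρ0]

end InfConvolution

/-! ### The quadratic upper model and the main theorem. -/

/-- The inf-convolution with a power of the `r`-norm has local quadratic upper models. -/
lemma exists_infSmoothing_add_le {n : ℕ} {r R : ℝ} (hr : 2 ≤ r) (hR : 0 < R)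
    [Fact (1 ≤ ENNReal.ofReal r)] {a : Seminorm ℝ (EuclideanSpace ℝ (Fin n))} (ha : Continuous a)
    (ha0 : ∀ x, a x = 0 → x = 0)
    (haρ : ∀ x, a x ≤ pSeminorm n (ENNReal.ofReal r) x)
    (hρa : ∀ x, pSeminorm n (ENNReal.ofReal r) x ≤ 3 * a x)
    {f : EuclideanSpace ℝ (Fin n) → ℝ} (hf : ∀ x y, |f x - f y| ≤ a (x - y))
    (x : EuclideanSpace ℝ (Fin n)) :
    ∃ g, ∀ d, a d ≤ R / (3 * r) →
      infSmoothing (pSeminorm n (ENNReal.ofReal r)) r (2 / (r * R ^ (r - 1))) (2 * R) f (x + d)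
        ≤ infSmoothing (pSeminorm n (ENNReal.ofReal r)) r (2 / (r * R ^ (r - 1))) (2 * R) f x
          + inner ℝ g d + 54 * r / R * a d ^ 2 := by
  have hr0 : 0 < r := by linarith
  set ρ := pSeminorm n (ENNReal.ofReal r) with hρ
  set c := 2 / (r * R ^ (r - 1)) with hc
  have hRr := Real.rpow_pos_of_pos hR (r - 1)
  have hRr2 := Real.rpow_pos_of_pos hR (r - 2)
  have hc0 : 0 < c := by positivity
  have hmin := exists_infSmoothing_eq (ρ := ρ) (c := c) continuous_pSeminorm
    (isCompact_pSeminorm_le (2 * R)) (by linarith) hr0.le (continuous_of_abs_sub_le_seminorm ha hf)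
  obtain ⟨h, hh, he, hhm⟩ := hmin x
  rw [he] at hhm
  have hhR : ρ h ≤ R := seminorm_le_of_isMin (by linarith) hR haρ hf hh hhm
  obtain ⟨g, hg⟩ := exists_pSeminorm_add_rpow_le hr h
  refine ⟨-(c • g), fun d hd => ?_⟩
  rcases eq_or_ne d 0 with rfl | hd0
  · simp
  have had : 0 < a d := (apply_nonneg a d).lt_of_ne fun h => hd0 (ha0 d h.symm)
  have hB : 3 * a d ≤ R * r⁻¹ := by
    rw [← div_eq_mul_inv, le_div_iff₀ hr0]
    rw [le_div_iff₀ (by positivity)] at hd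
    linarith
  have hi1 : r⁻¹ ≤ 1 := inv_le_one_of_one_le₀ (by linarith)
  have hρd : ρ (-d) ≤ 3 * a d := by rw [map_neg_eq_map]; exact hρa d
  obtain ⟨-, -, -, hm⟩ := hmin (x + d)
  -- Admissible because `ρ h ≤ R` and `ρ (-d) ≤ R / r`: this is the use of the larger radius `2 *
  -- R`.
  have h1 := hm (h + -d) (by
    have := map_add_le_add ρ h (-d)
    nlinarith)
  rw [show x + d + (h + -d) = x + h by abel] at h1
  have h2 := hg (-d) (R * (1 + r⁻¹)) (3 * a d) (by positivity) (by positivity)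
    (by rw [← hρ]; linarith) hρd
  -- The restriction `a d ≤ R / (3 * r)` is what keeps this power within a constant factor of `R ^
  -- (r - 2)`.
  have h3 : (R * (1 + r⁻¹)) ^ (r - 2) ≤ 3 * R ^ (r - 2) := by
    rw [Real.mul_rpow hR.le (by positivity), mul_comm]
    exact mul_le_mul_of_nonneg_right
      (one_add_inv_rpow_le hr0 (by linarith) (by linarith)) hRr2.le
  have h4 : c * (r * (r - 1) * ((R * (1 + r⁻¹)) ^ (r - 2) * (3 * a d) ^ 2))
      ≤ 54 * r / R * a d ^ 2 := by
    have hr1 : 0 ≤ r - 1 := by linarith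
    calc _ ≤ c * (r * (r - 1) * (3 * R ^ (r - 2) * (3 * a d) ^ 2)) := by gcongr
      _ = 54 * (r - 1) / R * a d ^ 2 := by
          rw [hc, rpow_sub_one_eq_rpow_sub_two_mul hR.le hr]
          field_simp; ring
      _ ≤ _ := by gcongr; linarith
  rw [inner_neg_right] at h2
  rw [he, inner_neg_left, inner_smul_left, conj_trivial]
  have h5 := mul_le_mul_of_nonneg_left h2 hc0.le
  linarith

theorem proposition2p1 :
    ∃ C : ℝ, 0 < C ∧
      ∀ (n : ℕ) (p : ℝ≥0∞) (χ : ℝ), 2 ≤ n → 2 ≤ p → 0 < χ →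
        ∃ S : (EuclideanSpace ℝ (Fin n) → ℝ) → (EuclideanSpace ℝ (Fin n) → ℝ),
          (∀ f ∈ convexLip p,
            ConvexOn ℝ Set.univ (S f) ∧
            ContDiff ℝ 1 (S f) ∧
            (∀ x, S f x ≤ f x ∧ f x - χ ≤ S f x) ∧
            (∀ x y,
              pNorm (ENNReal.conjExponent p) (gradient (S f) x - gradient (S f) y) ≤
                C * (min p (ENNReal.ofReal (Real.log n))).toReal * χ⁻¹ * pNorm p (x - y))) ∧
          (∀ x, ∃ U ∈ 𝓝 x, ∀ f ∈ convexLip p, ∀ g ∈ convexLip p,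
            Set.EqOn f g (pBall p x χ) → Set.EqOn (S f) (S g) U) := by
  -- With `R = χ / 4`, the gradient constant is `4 * 54 * r / R = 864 * r / χ`, and `r ≤ 4 * min p
  -- (log n)`.
  refine ⟨3456, by norm_num, fun n p χ hn hp hχ => ?_⟩
  obtain ⟨r, hr, hrn, hequiv⟩ := exists_exponent_pNorm_equiv hn hp
  have : Fact (1 ≤ p) := ⟨le_trans (by norm_num) hp⟩
  have : Fact (1 ≤ ENNReal.ofReal r) := ⟨by
    rw [ENNReal.one_le_ofReal]; linarith⟩
  have hR : 0 < χ / 4 := by positivity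
  have hr0 : 0 < r := by linarith
  have hRr := Real.rpow_pos_of_pos hR (r - 1)
  have haρ : ∀ x, pSeminorm n p x ≤ pSeminorm n (ENNReal.ofReal r) x := fun x => (hequiv x).1
  have hρa : ∀ x, pSeminorm n (ENNReal.ofReal r) x ≤ 3 * pSeminorm n p x := fun x => (hequiv x).2
  have hK := isCompact_pSeminorm_le (n := n) (p := ENNReal.ofReal r) (2 * (χ / 4))
  refine ⟨infSmoothing (pSeminorm n (ENNReal.ofReal r)) r (2 / (r * (χ / 4) ^ (r - 1)))
    (2 * (χ / 4)), fun f hf => ?_, fun x => ?_⟩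
  · have hconv := convexOn_infSmoothing (r := r) (c := 2 / (r * (χ / 4) ^ (r - 1)))
      continuous_pSeminorm hK (by positivity) (by linarith) (by positivity)
      (continuous_of_abs_sub_le_seminorm continuous_pSeminorm hf.2) hf.1
    obtain ⟨hC1, hgrad⟩ := hconv.contDiff_one_and_inner_gradient_sub_le
      (a := pSeminorm n p) continuous_pSeminorm (fun _ => eq_zero_of_pSeminorm_eq_zero)
      (abs_infSmoothing_sub_le continuous_pSeminorm hK (by positivity) hr0.le
        continuous_pSeminorm hf.2)
      (δ := χ / 4 / (3 * r)) (M := 54 * r / (χ / 4)) (by positivity) (by positivity)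
      -- Here `M * δ = 18`.
      (by field_simp; norm_num)
      (exists_infSmoothing_add_le hr hR continuous_pSeminorm
        (fun _ => eq_zero_of_pSeminorm_eq_zero) haρ hρa hf.2)
    refine ⟨hconv, hC1, fun x => ?_, fun x y => pNorm_conjExponent_le hp fun d hd => ?_⟩
    · have := infSmoothing_bounds (r := r) (c := 2 / (r * (χ / 4) ^ (r - 1)))
        continuous_pSeminorm hK (by positivity) hr0 (by positivity) continuous_pSeminorm haρ hf.2 x
      exact ⟨this.1, by linarith [this.2]⟩
    · have hxy : 0 ≤ pSeminorm n p (x - y) := apply_nonneg _ _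
      calc _ ≤ 4 * (54 * r / (χ / 4)) * pSeminorm n p (x - y) * pSeminorm n p d := hgrad x y d
        _ ≤ 4 * (54 * r / (χ / 4)) * pSeminorm n p (x - y) * 1 := by gcongr; exact hd
        _ = 864 * r * χ⁻¹ * pSeminorm n p (x - y) := by field_simp; ring
        _ ≤ 3456 * (min p (ENNReal.ofReal (Real.log n))).toReal * χ⁻¹
            * pSeminorm n p (x - y) := by
          have : 864 * r ≤ 3456 * (min p (ENNReal.ofReal (Real.log n))).toReal := by linarith
          gcongr
  · obtain ⟨U, hU, h⟩ := infSmoothing_eqOn (r := r) (c := 2 / (r * (χ / 4) ^ (r - 1)))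
      (continuous_pSeminorm (n := n) (p := p)) haρ
      (by linarith : 2 * (χ / 4) < χ) x
    exact ⟨U, hU, fun f _ g _ hfg => h f g hfg⟩
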